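/- For $n\ge 1$ let $B_n\in\mathbb R^{n\times n}$ be the (Luk–Tracy) upper-triangular matrix with entries $1$ on the diagonal, $-\tfrac12$ above it and $0$ below it. For an invertible real matrix $T$ let $\kappa(T)=\|T\|\,\|T^{-1}\|$, with $\|\cdot\|$ the operator norm for the Euclidean norm. For a matrix $B$ with linearly independent columns let $\mathcal L(B)$ be the lattice of integer combinations of its columns, and for full-rank lattices $\mathcal L_1,\mathcal L_2\subset\mathbb R^n$ let $\mathrm{dist}(\mathcal L_1,\mathcal L_2)=\min\{\kappa(T): T \text{ linear and invertible},\ T(\mathcal L_1)=\mathcal L_2\}$. A basis $b_1,\dots,b_n$ of a lattice $\mathcal L$, with Gram–Schmidt orthogonalization $\tilde b_1,\dots,\tilde b_n$, is HKZ-reduced if (1) $|\langle b_i,\tilde b_j\rangle|\le\tfrac12\langle\tilde b_j,\tilde b_j\rangle$ for all $j<i$; (2) $\|b_1\|=\lambda_1(\mathcal L)$, the length of a shortest nonzero vector of $\mathcal L$; and (3) if $n>1$, the projections of $b_2,\dots,b_n$ onto $b_1^\perp$ form an HKZ-reduced basis of the projection of $\mathcal L$ onto $b_1^\perp$. Theorem.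 For every $n\ge1$ the columns of $B_n$ form an HKZ-reduced basis of $\mathcal L(B_n)$, and the columns of the identity matrix $I_n$ form an HKZ-reduced basis of $\mathbb Z^n$. There are absolute constants $c,C>0$ such that for every $n\ge1$, $$\kappa(B_n)\ \ge\ c\cdot 1.5^{\,n}\qquad\text{and}\qquad \mathrm{dist}(\mathbb Z^n,\mathcal L(B_n))\ \le\ n^{C\log n}.$$ In particular, the map $B_nI_n^{-1}$ given by these two HKZ-reduced bases misses the optimal distortion by an exponential factor: there are constants $c'>0$ and $a>1$ such that $\kappa(B_nI_n^{-1})\ge c'\,a^{\,n}\cdot\mathrm{dist}(\mathbb Z^n,\mathcal L(B_n))$ for every $n\ge1$. -/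

import Mathlib

noncomputable section

namespace LatticeDistortion

/-- The family of columns of a square matrix, as vectors of Euclidean space. -/
def columns {n : ℕ} (B : Matrix (Fin n) (Fin n) ℝ) : Fin n → EuclideanSpace ℝ (Fin n) :=
  fun j => WithLp.toLp 2 (fun i => B i j)

/-- The lattice generated by a family of vectors: all its integer linear combinations. -/
def latticeOf {n : ℕ} {E : Type} [AddCommGroup E] (b : Fin n → E) : Submodule ℤ E :=
  Submodule.span ℤ (Set.range b)

/-- The lattice of integer vectors in `ℝⁿ`. -/
def integerLattice (n : ℕ) : Submodule ℤ (EuclideanSpace ℝ (Fin n)) where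
  carrier := {x | ∀ i, ∃ m : ℤ, x i = m}
  zero_mem' := fun _ => ⟨0, by simp⟩
  add_mem' := by
    intro x y hx hy i
    obtain ⟨k, hk⟩ := hx i
    obtain ⟨l, hl⟩ := hy i
    exact ⟨k + l, by simp [hk, hl]⟩
  smul_mem' := by
    intro c x hx i
    obtain ⟨k, hk⟩ := hx i
    exact ⟨c * k, by simp [hk]⟩

/-- The operator norm of a matrix with respect to the Euclidean norm. -/
def opNorm {n : ℕ} (T : Matrix (Fin n) (Fin n) ℝ) : ℝ :=
  ‖Matrix.toEuclideanCLM (n := Fin n) (𝕜 := ℝ) T‖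

/-- The condition number `‖T‖ ‖T⁻¹‖` (of an invertible matrix). -/
def condNumber {n : ℕ} (T : Matrix (Fin n) (Fin n) ℝ) : ℝ :=
  opNorm T * opNorm T⁻¹

/-- The condition numbers of the invertible linear maps `T` of `ℝⁿ` with `T(L₁) = L₂`. -/
def distortionValues {n : ℕ} (L₁ L₂ : Submodule ℤ (EuclideanSpace ℝ (Fin n))) : Set ℝ :=
  {κ | ∃ T : Matrix (Fin n) (Fin n) ℝ, IsUnit T.det ∧
    Matrix.toEuclideanCLM (n := Fin n) (𝕜 := ℝ) T ''
      (L₁ : Set (EuclideanSpace ℝ (Fin n))) = (L₂ : Set (EuclideanSpace ℝ (Fin n))) ∧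
    κ = condNumber T}

/-- The distortion between two lattices: the least condition number of a linear map that takes
the first lattice onto the second. -/
def latticeDist {n : ℕ} (L₁ L₂ : Submodule ℤ (EuclideanSpace ℝ (Fin n))) : ℝ :=
  sInf (distortionValues L₁ L₂)

section Reduction

variable {E : Type} [NormedAddCommGroup E] [InnerProductSpace ℝ E]

/-- The `i`-th successive minimum `inf {r > 0 : dim span (r · ball ∩ L) ≥ i}`. -/
def successiveMin (i : ℕ) (L : Submodule ℤ E) : ℝ :=
  sInf {r : ℝ | 0 < r ∧
    i ≤ Module.finrank ℝ (Submodule.span ℝ (Metric.closedBall (0 : E) r ∩ (L : Set E)))}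

/-- The Gram-Schmidt coefficient `⟨bᵢ, b̃ⱼ⟩ / ⟨b̃ⱼ, b̃ⱼ⟩`. -/
def gsCoeff {n : ℕ} (b : Fin n → E) (i j : Fin n) : ℝ :=
  inner ℝ (b i) (InnerProductSpace.gramSchmidt ℝ b j) /
    inner ℝ (InnerProductSpace.gramSchmidt ℝ b j) (InnerProductSpace.gramSchmidt ℝ b j)

/-- `b` is a basis of the lattice `L`. -/
def IsLatticeBasis {n : ℕ} (b : Fin n → E) (L : Submodule ℤ E) : Prop :=
  LinearIndependent ℝ b ∧ latticeOf b = L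

/-- `IsHKZ n b L`: the vectors `b 0, …, b (n - 1)` form a Hermite-Korkine-Zolotareff reduced
basis of the lattice `L`. They form a basis of `L`, all Gram-Schmidt coefficients below the
diagonal are at most `1/2` in absolute value, the first vector is a shortest nonzero vector of
`L`, and the projections of the other vectors onto the orthogonal complement of the first one
form an HKZ-reduced basis of the projection of `L`. -/
def IsHKZ : (n : ℕ) → (Fin n → E) → Submodule ℤ E → Prop
  | 0, b, L => IsLatticeBasis b L
  | n + 1, b, L =>
      IsLatticeBasis b L ∧
      (∀ i j : Fin (n + 1), j < i → |gsCoeff b i j| ≤ 1 / 2) ∧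
      ‖b 0‖ = successiveMin 1 L ∧
      IsHKZ n (fun i => (Submodule.span ℝ {b 0})ᗮ.starProjection (b i.succ))
        (L.map ((Submodule.span ℝ {b 0})ᗮ.starProjection.toLinearMap.restrictScalars ℤ))

end Reduction

/-- The Luk-Tracy matrix: upper triangular, ones on the diagonal, `-1/2` above it. -/
def lukTracy (n : ℕ) : Matrix (Fin n) (Fin n) ℝ :=
  Matrix.of fun i j => if j < i then 0 else if j = i then 1 else -(1 / 2)

end LatticeDistortion

end

/-!
The columns of the Luk-Tracy matrix are unitriangular over the standard basis, with entries at most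
`1/2` above the diagonal. The Gram-Schmidt vectors of such a family are the standard basis vectors;
the last nonzero coordinate of a nonzero lattice vector is an integer, so the first basis vector,
of length one, is a shortest one; and projecting away from it only deletes the first row and column
of the matrix. So induction on the dimension gives HKZ-reducedness
(`IsUnitriangularOver.isHKZ`), for the identity matrix as well.

Back substitution shows that the top right entry of the inverse of the Luk-Tracy matrix grows like
`(3/2) ^ n`, while its norm is at least one; this bounds the condition number from below
(`pow_le_condNumber_lukTracy`).

The lattice nevertheless has a well-conditioned basis, by a recursion of Seysen: cut the matrix into
two by two blocks of half the size, balance both diagonal blocks, and use an integral shear to bring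
the off-diagonal block to the form `A₁ * R` where the entries of `R` are at most `1/2`
(`HasBalancedBasis.fromBlocks`). Each doubling of the dimension costs a factor linear in the
dimension, in the entries both of the matrix and of its inverse, so that in dimension `2 ^ k` they
are at most `2 ^ k ^ 2` (`hasBalancedBasis_lukTracy`). This is `n ^ O(log n)`, which is
smaller than any exponential (`exists_rpow_mul_log_le`).

The distortion is attained because maps of bounded condition number between the two lattices
correspond to integer matrices with bounded entries (`finite_distortionValues_inter_Iic`).
-/

namespace LatticeDistortion

/-! ### Unitriangular families over an orthonormal family -/

section Unitriangular

variable {E : Type} [NormedAddCommGroup E] [InnerProductSpace ℝ E]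

/-- The family `b` is obtained from the orthonormal family `e` by an upper unitriangular matrix
whose entries above the diagonal are at most `1/2` in absolute value. The matrix is not a separate
datum: its entries are the inner products `⟪e i, b j⟫`. -/
structure IsUnitriangularOver {n : ℕ} (e b : Fin n → E) : Prop where
  orthonormal : Orthonormal ℝ e
  expansion : ∀ j, b j = ∑ i, (inner ℝ (e i) (b j) : ℝ) • e i
  diag : ∀ j, (inner ℝ (e j) (b j) : ℝ) = 1
  lower : ∀ i j, j < i → (inner ℝ (e i) (b j) : ℝ) = 0
  upper : ∀ i j, i < j → |(inner ℝ (e i) (b j) : ℝ)| ≤ 1 / 2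

namespace IsUnitriangularOver

variable {n : ℕ} {e b : Fin n → E}

/-- Read off from the last nonzero coefficient. -/
theorem exists_inner_eq (h : IsUnitriangularOver e b) {g : Fin n → ℝ} (hg : g ≠ 0) :
    ∃ j, g j ≠ 0 ∧ (inner ℝ (e j) (∑ i, g i • b i) : ℝ) = g j := by
  obtain ⟨k, hk⟩ := Function.ne_iff.mp hg
  obtain ⟨j, hj, hmax⟩ := Finset.exists_max_image (Finset.univ.filter fun i => g i ≠ 0) id
    ⟨k, by simpa using hk⟩
  have hj' : g j ≠ 0 := by simpa using hj
  refine ⟨j, hj', ?_⟩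
  rw [inner_sum, Finset.sum_eq_single j]
  · rw [real_inner_smul_right, h.diag, mul_one]
  · intro i _ hij
    rw [real_inner_smul_right]
    rcases lt_or_gt_of_ne hij with hlt | hgt
    · rw [h.lower j i hlt, mul_zero]
    · have : g i = 0 := by
        by_contra hne
        exact absurd (hmax i (by simpa using hne)) (not_le.mpr hgt)
      rw [this, zero_mul]
  · simp

theorem linearIndependent (h : IsUnitriangularOver e b) : LinearIndependent ℝ b := by
  rw [Fintype.linearIndependent_iff]
  intro g hg i
  by_contra hi
  obtain ⟨j, hj, hj'⟩ := h.exists_inner_eq (g := g) (fun h0 => hi (congrFun h0 i))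
  rw [hg, inner_zero_right] at hj'
  exact hj hj'.symm

/-- The last nonzero coordinate of a nonzero lattice vector is an integer. -/
theorem one_le_norm (h : IsUnitriangularOver e b) {x : E} (hx : x ∈ latticeOf b) (hx0 : x ≠ 0) :
    1 ≤ ‖x‖ := by
  obtain ⟨z, rfl⟩ := (Submodule.mem_span_range_iff_exists_fun ℤ).mp hx
  have hsum : ∑ i, z i • b i = ∑ i, (z i : ℝ) • b i := by
    simp only [Int.cast_smul_eq_zsmul]
  rw [hsum] at hx0 ⊢
  obtain ⟨j, hj, hj'⟩ := h.exists_inner_eq (g := fun i => (z i : ℝ)) (by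
    intro h0
    exact hx0 (by simp [fun i => congrFun h0 i]))
  have hz : (1 : ℝ) ≤ |(z j : ℝ)| := by
    have : z j ≠ 0 := by exact_mod_cast hj
    exact_mod_cast Int.one_le_abs this
  calc (1 : ℝ) ≤ |(z j : ℝ)| := hz
    _ = |(inner ℝ (e j) (∑ i, (z i : ℝ) • b i) : ℝ)| := by rw [hj']
    _ ≤ ‖e j‖ * ‖∑ i, (z i : ℝ) • b i‖ := abs_real_inner_le_norm _ _
    _ = _ := by rw [h.orthonormal.1 j, one_mul]

theorem gramSchmidt_eq (h : IsUnitriangularOver e b) :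
    InnerProductSpace.gramSchmidt ℝ b = e := by
  funext j
  induction j using WellFoundedLT.induction with
  | ind j ih =>
    rw [InnerProductSpace.gramSchmidt_def]
    have hproj : ∀ i ∈ Finset.Iio j,
        (Submodule.span ℝ {InnerProductSpace.gramSchmidt ℝ b i}).starProjection (b j) =
          (inner ℝ (e i) (b j) : ℝ) • e i := by
      intro i hi
      rw [ih i (Finset.mem_Iio.mp hi)]
      exact Submodule.starProjection_unit_singleton ℝ (h.orthonormal.1 i) (b j)
    rw [Finset.sum_congr rfl hproj, sub_eq_iff_eq_add]
    conv_lhs => rw [h.expansion j]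
    rw [← Finset.sum_subset (Finset.subset_univ (Finset.Iic j)), Finset.Iic_eq_cons_Iio,
      Finset.sum_cons, h.diag, one_smul]
    intro i _ hi
    rw [h.lower i j (by simpa using hi), zero_smul]

theorem first_eq {e b : Fin (n + 1) → E} (h : IsUnitriangularOver e b) : b 0 = e 0 := by
  rw [h.expansion 0, Fin.sum_univ_succ, h.diag, one_smul,
    Finset.sum_eq_zero fun i _ => by rw [h.lower _ _ (Fin.succ_pos i), zero_smul], add_zero]

theorem successiveMin_one [FiniteDimensional ℝ E] {e b : Fin (n + 1) → E}
    (h : IsUnitriangularOver e b) : successiveMin 1 (latticeOf b) = 1 := by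
  have hset : {r : ℝ | 0 < r ∧ 1 ≤ Module.finrank ℝ (Submodule.span ℝ
      (Metric.closedBall (0 : E) r ∩ (latticeOf b : Set E)))} = Set.Ici 1 := by
    ext r
    simp only [Set.mem_ofPred_eq, Set.mem_Ici]
    constructor
    · rintro ⟨_, hr⟩
      by_contra hlt
      have hbot : Submodule.span ℝ (Metric.closedBall (0 : E) r ∩ (latticeOf b : Set E)) = ⊥ := by
        rw [Submodule.span_eq_bot]
        rintro x ⟨hxr, hxL⟩
        by_contra hx0
        have := h.one_le_norm hxL hx0
        rw [mem_closedBall_zero_iff] at hxr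
        exact hlt (this.trans hxr)
      rw [hbot, finrank_bot] at hr
      omega
    · intro hr
      refine ⟨by linarith, ?_⟩
      rw [Nat.one_le_iff_ne_zero, Ne, Submodule.finrank_eq_zero, Submodule.span_eq_bot]
      intro hall
      have hb : ‖b 0‖ = 1 := by rw [h.first_eq, h.orthonormal.1]
      have := hall (b 0) ⟨by rw [mem_closedBall_zero_iff, hb]; exact hr,
        Submodule.subset_span ⟨0, rfl⟩⟩
      rw [this, norm_zero] at hb
      exact zero_ne_one hb
  rw [successiveMin, hset, csInf_Ici]

theorem starProjection_apply {e b : Fin (n + 1) → E} (h : IsUnitriangularOver e b) (x : E) :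
    (Submodule.span ℝ {b 0})ᗮ.starProjection x = x - (inner ℝ (e 0) x : ℝ) • e 0 := by
  rw [Submodule.starProjection_orthogonal_val, h.first_eq,
    Submodule.starProjection_unit_singleton ℝ (h.orthonormal.1 0)]

/-- Projecting away from the first vector deletes the first row and column of the matrix. -/
theorem tail {e b : Fin (n + 1) → E} (h : IsUnitriangularOver e b) :
    IsUnitriangularOver (fun i => e i.succ)
      (fun i => (Submodule.span ℝ {b 0})ᗮ.starProjection (b i.succ)) := by
  have hinner : ∀ i j : Fin n,
      (inner ℝ (e i.succ) ((Submodule.span ℝ {b 0})ᗮ.starProjection (b j.succ)) : ℝ) =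
        inner ℝ (e i.succ) (b j.succ) := by
    intro i j
    rw [h.starProjection_apply, inner_sub_right, real_inner_smul_right,
      h.orthonormal.2 (Fin.succ_ne_zero i), mul_zero, sub_zero]
  refine ⟨h.orthonormal.comp _ (Fin.succ_injective n), fun j => ?_, fun j => ?_,
    fun i j hij => ?_, fun i j hij => ?_⟩
  · simp only [hinner]
    rw [h.starProjection_apply, sub_eq_iff_eq_add']
    exact (h.expansion j.succ).trans (Fin.sum_univ_succ _)
  · rw [hinner, h.diag]
  · rw [hinner, h.lower _ _ (Fin.succ_lt_succ_iff.mpr hij)]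
  · rw [hinner]
    exact h.upper _ _ (Fin.succ_lt_succ_iff.mpr hij)

theorem map_latticeOf {e b : Fin (n + 1) → E} (h : IsUnitriangularOver e b) :
    (latticeOf b).map
        ((Submodule.span ℝ {b 0})ᗮ.starProjection.toLinearMap.restrictScalars ℤ) =
      latticeOf (fun i => (Submodule.span ℝ {b 0})ᗮ.starProjection (b i.succ)) := by
  have h0 : (Submodule.span ℝ {b 0})ᗮ.starProjection (b 0) = 0 := by
    rw [h.starProjection_apply, h.diag, one_smul, h.first_eq, sub_self]
  rw [latticeOf, latticeOf, Submodule.map_span, ← Set.range_comp]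
  have hrange : Set.range
      (((Submodule.span ℝ {b 0})ᗮ.starProjection.toLinearMap.restrictScalars ℤ) ∘ b) =
      insert 0 (Set.range fun i : Fin n =>
        (Submodule.span ℝ {b 0})ᗮ.starProjection (b i.succ)) := by
    ext x
    simp only [Set.mem_range, Fin.exists_fin_succ, Set.mem_insert_iff, Function.comp_apply,
      LinearMap.coe_restrictScalars, ContinuousLinearMap.coe_coe, h0, eq_comm]
  rw [hrange, Submodule.span_insert_zero]

theorem isHKZ [FiniteDimensional ℝ E] (h : IsUnitriangularOver e b) :
    IsHKZ n b (latticeOf b) := by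
  induction n with
  | zero => exact ⟨h.linearIndependent, rfl⟩
  | succ n ih =>
    refine ⟨⟨h.linearIndependent, rfl⟩, fun i j hij => ?_, ?_, ?_⟩
    · rw [gsCoeff, h.gramSchmidt_eq, real_inner_self_eq_norm_sq, h.orthonormal.1, one_pow,
        div_one, real_inner_comm]
      exact h.upper j i hij
    · rw [h.successiveMin_one, h.first_eq, h.orthonormal.1]
    · rw [h.map_latticeOf]
      exact ih h.tail

end IsUnitriangularOver

end Unitriangular

/-- The columns of an upper unitriangular matrix are written over the standard basis. -/
theorem isUnitriangularOver_columns {n : ℕ} {B : Matrix (Fin n) (Fin n) ℝ}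
    (hdiag : ∀ i, B i i = 1) (hlower : ∀ i j, j < i → B i j = 0)
    (hupper : ∀ i j, i < j → |B i j| ≤ 1 / 2) :
    IsUnitriangularOver (EuclideanSpace.basisFun (Fin n) ℝ) (columns B) := by
  have hinner : ∀ i j,
      (inner ℝ (EuclideanSpace.basisFun (Fin n) ℝ i) (columns B j) : ℝ) = B i j := by
    intro i j
    rw [EuclideanSpace.basisFun_inner]
    rfl
  refine ⟨(EuclideanSpace.basisFun (Fin n) ℝ).orthonormal, fun j => ?_, fun j => ?_,
    fun i j hij => ?_, fun i j hij => ?_⟩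
  · exact ((EuclideanSpace.basisFun (Fin n) ℝ).sum_repr' _).symm
  · rw [hinner, hdiag]
  · rw [hinner, hlower i j hij]
  · rw [hinner]
    exact hupper i j hij

theorem isUnitriangularOver_lukTracy (n : ℕ) :
    IsUnitriangularOver (EuclideanSpace.basisFun (Fin n) ℝ) (columns (lukTracy n)) := by
  apply isUnitriangularOver_columns
  · simp [lukTracy]
  · intro i j hij
    simp [lukTracy, hij]
  · intro i j hij
    simp [lukTracy, hij.not_gt, hij.ne']

theorem isUnitriangularOver_one (n : ℕ) :
    IsUnitriangularOver (EuclideanSpace.basisFun (Fin n) ℝ)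
      (columns (1 : Matrix (Fin n) (Fin n) ℝ)) := by
  apply isUnitriangularOver_columns
  · simp
  · intro i j hij
    simp [hij.ne']
  · intro i j hij
    simp [hij.ne]

/-! ### Lattices, matrices and the operator norm -/

theorem mem_latticeOf_columns {n : ℕ} (B : Matrix (Fin n) (Fin n) ℝ)
    (x : EuclideanSpace ℝ (Fin n)) :
    x ∈ latticeOf (columns B) ↔
      ∃ z : Fin n → ℤ, x = WithLp.toLp 2 (B.mulVec fun i => (z i : ℝ)) := by
  rw [latticeOf, Submodule.mem_span_range_iff_exists_fun]
  refine exists_congr fun z => ?_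
  have hz : ∑ i, z i • columns B i = WithLp.toLp 2 (B.mulVec fun i => (z i : ℝ)) := by
    ext i
    simp [columns, Matrix.mulVec, dotProduct, mul_comm]
  rw [hz, eq_comm]

theorem latticeOf_columns_one (n : ℕ) :
    latticeOf (columns (1 : Matrix (Fin n) (Fin n) ℝ)) = integerLattice n := by
  ext x
  rw [mem_latticeOf_columns]
  simp only [Matrix.one_mulVec]
  constructor
  · rintro ⟨z, rfl⟩ i
    exact ⟨z i, rfl⟩
  · intro hx
    choose z hz using hx
    exact ⟨z, by ext i; exact hz i⟩

theorem mem_integerLattice {n : ℕ} (x : EuclideanSpace ℝ (Fin n)) :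
    x ∈ integerLattice n ↔ ∃ z : Fin n → ℤ, x = WithLp.toLp 2 fun i => (z i : ℝ) := by
  rw [← latticeOf_columns_one, mem_latticeOf_columns]
  simp only [Matrix.one_mulVec]

theorem toEuclideanCLM_toLp {n : ℕ} (T : Matrix (Fin n) (Fin n) ℝ) (v : Fin n → ℝ) :
    Matrix.toEuclideanCLM (n := Fin n) (𝕜 := ℝ) T (WithLp.toLp 2 v) =
      WithLp.toLp 2 (T.mulVec v) := rfl

theorem opNorm_nonneg {n : ℕ} (T : Matrix (Fin n) (Fin n) ℝ) : 0 ≤ opNorm T := norm_nonneg _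

theorem norm_toLp_mulVec_le {n : ℕ} (T : Matrix (Fin n) (Fin n) ℝ) (v : Fin n → ℝ) :
    ‖WithLp.toLp 2 (T.mulVec v)‖ ≤ opNorm T * ‖WithLp.toLp 2 v‖ :=
  (Matrix.toEuclideanCLM (n := Fin n) (𝕜 := ℝ) T).le_opNorm (WithLp.toLp 2 v)

theorem abs_apply_le_opNorm {n : ℕ} (T : Matrix (Fin n) (Fin n) ℝ) (i j : Fin n) :
    |T i j| ≤ opNorm T := by
  have h := norm_toLp_mulVec_le T (Pi.single j 1)
  have hsingle : ‖WithLp.toLp 2 (Pi.single j (1 : ℝ) : Fin n → ℝ)‖ = 1 := by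
    simp
  rw [hsingle, mul_one, Matrix.mulVec_single_one] at h
  exact (PiLp.norm_apply_le (WithLp.toLp 2 (T.col j)) i).trans h

theorem opNorm_le_of_abs_apply_le {n : ℕ} {T : Matrix (Fin n) (Fin n) ℝ} {K : ℝ} (hK : 0 ≤ K)
    (h : ∀ i j, |T i j| ≤ K) : opNorm T ≤ n * K := by
  refine ContinuousLinearMap.opNorm_le_bound _ (by positivity) fun x => ?_
  refine le_of_sq_le_sq ?_ (by positivity)
  rw [EuclideanSpace.norm_sq_eq, mul_pow, EuclideanSpace.norm_sq_eq]
  have hrow : ∀ i, ‖(Matrix.toEuclideanCLM (n := Fin n) (𝕜 := ℝ) T x) i‖ ^ 2 ≤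
      n * K ^ 2 * ∑ j, ‖x j‖ ^ 2 := by
    intro i
    have hi : (Matrix.toEuclideanCLM (n := Fin n) (𝕜 := ℝ) T x) i = ∑ j, T i j * x j := rfl
    rw [hi, Real.norm_eq_abs, sq_abs]
    refine (Finset.sum_mul_sq_le_sq_mul_sq _ _ _).trans ?_
    simp only [Real.norm_eq_abs, sq_abs]
    refine mul_le_mul_of_nonneg_right ?_ (Finset.sum_nonneg fun j _ => sq_nonneg _)
    calc ∑ j, T i j ^ 2 ≤ ∑ _j : Fin n, K ^ 2 :=
          Finset.sum_le_sum fun j _ => sq_le_sq.mpr ((h i j).trans (le_abs_self K))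
      _ = n * K ^ 2 := by simp
  calc _ ≤ ∑ _i : Fin n, n * K ^ 2 * ∑ j, ‖x j‖ ^ 2 := Finset.sum_le_sum fun i _ => hrow i
    _ = (n * K) ^ 2 * ∑ j, ‖x j‖ ^ 2 := by simp; ring

theorem det_lukTracy (n : ℕ) : (lukTracy n).det = 1 := by
  rw [Matrix.det_of_isUpperTriangular]
  · simp [lukTracy]
  · intro i j hij
    have : j < i := hij
    simp [lukTracy, this]

/-! ### The condition number of the Luk-Tracy matrix -/

theorem lukTracy_mulVec {n : ℕ} (v : Fin n → ℝ) (i : Fin n) :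
    (lukTracy n).mulVec v i = v i - (1 / 2) * ∑ j ∈ Finset.Ioi i, v j := by
  have hsplit : ∀ j, lukTracy n i j * v j =
      (if j = i then v j else 0) - (1 / 2) * (if j ∈ Finset.Ioi i then v j else 0) := by
    intro j
    rcases lt_trichotomy j i with h | h | h
    · simp [lukTracy, h, h.ne, h.not_gt]
    · simp [lukTracy, h]
    · simp [lukTracy, h, h.ne', h.not_gt]
  rw [Matrix.mulVec, dotProduct, Finset.sum_congr rfl fun j _ => hsplit j,
    Finset.sum_sub_distrib, ← Finset.mul_sum, Finset.sum_ite_mem]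
  simp

/-- The last column of `(lukTracy (n + 1))⁻¹`: it is `1` at the end and grows by the factor `3/2`
with each step towards the front. -/
noncomputable def lukTracyInvLast (n : ℕ) (i : Fin (n + 1)) : ℝ :=
  if i = Fin.last n then 1 else (1 / 2) * (3 / 2) ^ (n - 1 - (i : ℕ))

theorem sum_Ioi_lukTracyInvLast (n m : ℕ) (i : Fin (n + 1)) (h : (i : ℕ) + m + 1 = n) :
    ∑ j ∈ Finset.Ioi i, lukTracyInvLast n j = (3 / 2) ^ m := by
  induction m generalizing i with
  | zero =>
    have : Finset.Ioi i = {Fin.last n} := by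
      ext j
      simp only [Finset.mem_Ioi, Finset.mem_singleton, Fin.lt_def, Fin.ext_iff, Fin.val_last]
      omega
    rw [this, Finset.sum_singleton, lukTracyInvLast, if_pos rfl, pow_zero]
  | succ m ih =>
    have hlt : (i : ℕ) + 1 < n + 1 := by omega
    have hIoi : Finset.Ioi i = Finset.cons ⟨i + 1, hlt⟩ (Finset.Ioi ⟨i + 1, hlt⟩) (by simp) := by
      ext j
      simp only [Finset.mem_Ioi, Finset.mem_cons, Fin.lt_def, Fin.ext_iff]
      omega
    rw [hIoi, Finset.sum_cons, ih ⟨i + 1, hlt⟩ (by simp only; omega), lukTracyInvLast,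
      if_neg (by rw [Fin.ext_iff, Fin.val_last]; simp only; omega)]
    have : n - 1 - (i + 1) = m := by omega
    simp only [this]
    ring

theorem lukTracy_mulVec_invLast (n : ℕ) :
    (lukTracy (n + 1)).mulVec (lukTracyInvLast n) = Pi.single (Fin.last n) 1 := by
  funext i
  rw [lukTracy_mulVec]
  by_cases hi : i = Fin.last n
  · subst hi
    have : Finset.Ioi (Fin.last n) = ∅ := by
      ext j
      simp [Fin.le_last]
    simp [this, lukTracyInvLast]
  · have hlt : (i : ℕ) < n := Fin.val_lt_last hi
    rw [sum_Ioi_lukTracyInvLast n (n - 1 - i) i (by omega), lukTracyInvLast, if_neg hi,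
      Pi.single_eq_of_ne hi, sub_self]

theorem lukTracy_inv_apply_last (n : ℕ) (i : Fin (n + 1)) :
    (lukTracy (n + 1))⁻¹ i (Fin.last n) = lukTracyInvLast n i := by
  have h : (lukTracy (n + 1))⁻¹.mulVec (Pi.single (Fin.last n) 1) = lukTracyInvLast n := by
    rw [← lukTracy_mulVec_invLast, Matrix.mulVec_mulVec,
      Matrix.nonsing_inv_mul _ (by rw [det_lukTracy]; exact isUnit_one), Matrix.one_mulVec]
  rw [Matrix.mulVec_single_one] at h
  exact congrFun h i

theorem pow_le_condNumber_lukTracy {n : ℕ} (hn : 1 ≤ n) :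
    2 / 9 * (3 / 2 : ℝ) ^ n ≤ condNumber (lukTracy n) := by
  obtain ⟨m, rfl⟩ : ∃ m, n = m + 1 := ⟨n - 1, by omega⟩
  have h1 : (1 : ℝ) ≤ opNorm (lukTracy (m + 1)) := by
    simpa [lukTracy] using abs_apply_le_opNorm (lukTracy (m + 1)) 0 0
  have h2 : 2 / 9 * (3 / 2 : ℝ) ^ (m + 1) ≤ opNorm (lukTracy (m + 1))⁻¹ := by
    have h := abs_apply_le_opNorm (lukTracy (m + 1))⁻¹ 0 (Fin.last m)
    rw [lukTracy_inv_apply_last] at h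
    refine le_trans (le_trans ?_ (le_abs_self _)) h
    rcases m with _ | m
    · norm_num [lukTracyInvLast]
    · rw [lukTracyInvLast, if_neg (Fin.last_pos).ne]
      simp only [Nat.add_sub_cancel, Fin.val_zero, Nat.sub_zero]
      exact le_of_eq (by ring)
  calc _ = 1 * (2 / 9 * (3 / 2 : ℝ) ^ (m + 1)) := (one_mul _).symm
    _ ≤ _ := mul_le_mul h1 h2 (by positivity) (opNorm_nonneg _)

/-! ### A well-conditioned basis of the lattice -/

theorem abs_mul_apply_le {l ι κ : Type*} [Fintype ι] (P : Matrix l ι ℝ) (Q : Matrix ι κ ℝ) {p q : ℝ}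
    (hp : 0 ≤ p) (hP : ∀ i j, |P i j| ≤ p) (hQ : ∀ i j, |Q i j| ≤ q) (i : l) (k : κ) :
    |(P * Q) i k| ≤ Fintype.card ι * (p * q) := by
  rw [Matrix.mul_apply]
  refine (Finset.abs_sum_le_sum_abs _ _).trans ?_
  calc ∑ j, |P i j * Q j k| ≤ ∑ _j : ι, p * q := Finset.sum_le_sum fun j _ => by
        rw [abs_mul]
        exact mul_le_mul (hP _ _) (hQ _ _) (abs_nonneg _) hp
    _ = _ := by simp

/-- Some unimodular change of basis `U` makes all entries of `B * U` and of its inverse at most `K`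
in absolute value. The inverses of `U` and of `B * U` are given as matrices, so that over an
arbitrary finite index type no determinant is needed. -/
def HasBalancedBasis {ι : Type*} [Fintype ι] [DecidableEq ι] (B : Matrix ι ι ℝ) (K : ℝ) : Prop :=
  ∃ (U U' : Matrix ι ι ℤ) (A : Matrix ι ι ℝ), U * U' = 1 ∧
    (B * U.map (Int.cast : ℤ → ℝ)) * A = 1 ∧
    (∀ i j, |(B * U.map (Int.cast : ℤ → ℝ)) i j| ≤ K) ∧ ∀ i j, |A i j| ≤ K

namespace HasBalancedBasis

variable {ι κ : Type*} [Fintype ι] [DecidableEq ι] [Fintype κ] [DecidableEq κ]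

theorem mono {B : Matrix ι ι ℝ} {K L : ℝ} (h : HasBalancedBasis B K) (hKL : K ≤ L) :
    HasBalancedBasis B L := by
  obtain ⟨U, U', A, h1, h2, h3, h4⟩ := h
  exact ⟨U, U', A, h1, h2, fun i j => (h3 i j).trans hKL, fun i j => (h4 i j).trans hKL⟩

theorem reindex {B : Matrix ι ι ℝ} {K : ℝ} (h : HasBalancedBasis B K) (f : ι ≃ κ) :
    HasBalancedBasis (B.submatrix f.symm f.symm) K := by
  obtain ⟨U, U', A, h1, h2, h3, h4⟩ := h
  refine ⟨U.submatrix f.symm f.symm, U'.submatrix f.symm f.symm, A.submatrix f.symm f.symm,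
    ?_, ?_, fun i j => ?_, fun i j => h4 _ _⟩
  · rw [Matrix.submatrix_mul_equiv, h1, Matrix.submatrix_one_equiv]
  · rw [← Matrix.submatrix_map, Matrix.submatrix_mul_equiv, Matrix.submatrix_mul_equiv, h2,
      Matrix.submatrix_one_equiv]
  · rw [← Matrix.submatrix_map, Matrix.submatrix_mul_equiv]
    exact h3 _ _

/-- Seysen's step: if the bases of the diagonal blocks are balanced, then an integral shear takes
the off-diagonal block to `A₁ * R`, where `A₁` is the first balanced block and the entries of `R`
are at most `1/2`. The off-diagonal block of the inverse is then `-R * A₂⁻¹`, so that neither is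
larger than the diagonal blocks by more than a factor of the order of the dimension. -/
theorem fromBlocks {B₁ : Matrix ι ι ℝ} {B₂ : Matrix κ κ ℝ} {K : ℝ} {m : ℕ}
    (h₁ : HasBalancedBasis B₁ K) (h₂ : HasBalancedBasis B₂ K) (X : Matrix ι κ ℝ) (hK : 0 ≤ K)
    (hm : 1 ≤ m) (hι : Fintype.card ι ≤ m) (hκ : Fintype.card κ ≤ m) :
    HasBalancedBasis (Matrix.fromBlocks B₁ X 0 B₂) (m * K) := by
  obtain ⟨U₁, U₁', A₁, hU₁, hA₁, hB₁, hAb₁⟩ := h₁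
  obtain ⟨U₂, U₂', A₂, hU₂, hA₂, hB₂, hAb₂⟩ := h₂
  set Y : Matrix ι κ ℝ := A₁ * X * U₂.map (Int.cast : ℤ → ℝ) with hY
  set W : Matrix ι κ ℤ := Matrix.of fun i j => -round (Y i j) with hW
  set R : Matrix ι κ ℝ := W.map (Int.cast : ℤ → ℝ) + Y with hR
  have hRb : ∀ i j, |R i j| ≤ 1 / 2 := by
    intro i j
    have : R i j = Y i j - round (Y i j) := by
      simp [hR, hW]
      ring
    rw [this]
    exact abs_sub_round _
  have hmapmul : (U₁ * W).map (Int.cast : ℤ → ℝ) =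
      U₁.map (Int.cast : ℤ → ℝ) * W.map (Int.cast : ℤ → ℝ) :=
    Matrix.map_mul (f := Int.castRingHom ℝ)
  have hprod : Matrix.fromBlocks B₁ X 0 B₂ *
      (Matrix.fromBlocks U₁ (U₁ * W) 0 U₂).map (Int.cast : ℤ → ℝ) =
      Matrix.fromBlocks (B₁ * U₁.map (Int.cast : ℤ → ℝ))
        (B₁ * U₁.map (Int.cast : ℤ → ℝ) * R) 0 (B₂ * U₂.map (Int.cast : ℤ → ℝ)) := by
    have hX : B₁ * U₁.map (Int.cast : ℤ → ℝ) * Y = X * U₂.map (Int.cast : ℤ → ℝ) := by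
      rw [hY, Matrix.mul_assoc A₁, ← Matrix.mul_assoc, hA₁, Matrix.one_mul]
    rw [Matrix.fromBlocks_map, Matrix.fromBlocks_multiply, hmapmul, hR, Matrix.mul_add, hX]
    simp [Matrix.mul_assoc]
  have hmK : K ≤ m * K := le_mul_of_one_le_left hK (by exact_mod_cast hm)
  have hcard : ∀ c : ℕ, c ≤ m → (c : ℝ) * (K * (1 / 2)) ≤ m * K := by
    intro c hc
    have hc' : (c : ℝ) ≤ m := by exact_mod_cast hc
    exact mul_le_mul hc' (by linarith) (by positivity) (by positivity)
  refine ⟨Matrix.fromBlocks U₁ (U₁ * W) 0 U₂, Matrix.fromBlocks U₁' (-(W * U₂')) 0 U₂',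
    Matrix.fromBlocks A₁ (-(R * A₂)) 0 A₂, ?_, ?_, ?_, ?_⟩
  · rw [Matrix.fromBlocks_multiply, hU₁]
    simp [Matrix.mul_assoc, hU₂, Matrix.fromBlocks_one]
  · rw [hprod, Matrix.fromBlocks_multiply, hA₁]
    simp only [Matrix.mul_neg, Matrix.mul_zero, add_zero, Matrix.zero_mul, zero_add, neg_zero,
      Matrix.mul_assoc _ R, hA₂]
    simp [Matrix.fromBlocks_one]
  · rw [hprod]
    rintro (i | i) (j | j)
    · exact (hB₁ i j).trans hmK
    · exact (abs_mul_apply_le _ _ hK hB₁ hRb i j).trans (hcard _ hι)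
    · simpa using hK.trans hmK
    · exact (hB₂ i j).trans hmK
  · rintro (i | i) (j | j)
    · exact (hAb₁ i j).trans hmK
    · rw [Matrix.fromBlocks_apply₁₂, Matrix.neg_apply, abs_neg]
      refine (abs_mul_apply_le _ _ (by norm_num) hRb hAb₂ i j).trans ?_
      rw [mul_comm (1 / 2 : ℝ)]
      exact hcard _ hκ
    · simpa using hK.trans hmK
    · exact (hAb₂ i j).trans hmK

end HasBalancedBasis

theorem lukTracy_add (m k : ℕ) :
    lukTracy (m + k) = (Matrix.fromBlocks (lukTracy m)
      (Matrix.of fun _ _ => -(1 / 2)) 0 (lukTracy k)).submatrix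
        finSumFinEquiv.symm finSumFinEquiv.symm := by
  rw [← Matrix.reindex_apply, ← Equiv.symm_apply_eq]
  ext (i | i) (j | j)
  · have h : Fin.castAdd k j < Fin.castAdd k i ↔ j < i := Iff.rfl
    simp [lukTracy, h]
  · have h : Fin.castAdd k i < Fin.natAdd m j := by
      rw [Fin.lt_def, Fin.val_castAdd, Fin.val_natAdd]
      omega
    simp [lukTracy, h.not_gt, h.ne']
  · have h : Fin.castAdd k j < Fin.natAdd m i := by
      rw [Fin.lt_def, Fin.val_castAdd, Fin.val_natAdd]
      omega
    simp [lukTracy, h]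
  · simp [lukTracy]

theorem hasBalancedBasis_lukTracy (k : ℕ) {n : ℕ} (hn : n ≤ 2 ^ k) :
    HasBalancedBasis (lukTracy n) (2 ^ k ^ 2) := by
  induction k generalizing n with
  | zero =>
    have : Subsingleton (Fin n) := Fin.subsingleton_iff_le_one.mpr (by simpa using hn)
    have hone : lukTracy n = 1 := by
      ext i j
      rw [Subsingleton.elim i j]
      simp [lukTracy]
    have hentry : ∀ i j, |(1 : Matrix (Fin n) (Fin n) ℝ) i j| ≤ 2 ^ 0 ^ 2 := by
      intro i j
      rw [Subsingleton.elim i j]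
      simp
    rw [hone]
    refine ⟨1, 1, 1, by simp, by simp, fun i j => ?_, hentry⟩
    simpa using hentry i j
  | succ k ih =>
    rw [pow_succ] at hn
    obtain ⟨p, q, rfl, hp, hq⟩ : ∃ p q, n = p + q ∧ p ≤ 2 ^ k ∧ q ≤ 2 ^ k :=
      ⟨n / 2, n - n / 2, by omega, by omega, by omega⟩
    rw [lukTracy_add]
    refine HasBalancedBasis.mono (HasBalancedBasis.reindex (HasBalancedBasis.fromBlocks (m := 2 ^ k)
      (ih hp) (ih hq) _ (by positivity) Nat.one_le_two_pow (by simpa using hp) (by simpa using hq))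
      finSumFinEquiv) ?_
    rw [Nat.cast_pow, Nat.cast_ofNat, ← pow_add]
    exact pow_le_pow_right₀ one_le_two (by nlinarith)

/-! ### The distortion between the two lattices -/

section Distortion

variable {n : ℕ}

/-- A matrix that takes the integer lattice onto the lattice of `B` is `B` times an integer
matrix. -/
theorem exists_eq_mul_map_of_image {B T : Matrix (Fin n) (Fin n) ℝ}
    (h : Matrix.toEuclideanCLM (n := Fin n) (𝕜 := ℝ) T ''
      (integerLattice n : Set (EuclideanSpace ℝ (Fin n))) =
        (latticeOf (columns B) : Set (EuclideanSpace ℝ (Fin n)))) :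
    ∃ U : Matrix (Fin n) (Fin n) ℤ, T = B * U.map (Int.cast : ℤ → ℝ) := by
  have hcol : ∀ j, ∃ z : Fin n → ℤ, T.col j = B.mulVec fun i => (z i : ℝ) := by
    intro j
    have hmem : WithLp.toLp 2 (T.mulVec (Pi.single j 1)) ∈ latticeOf (columns B) := by
      rw [← SetLike.mem_coe, ← h]
      refine ⟨WithLp.toLp 2 (Pi.single j 1), ?_, rfl⟩
      refine (mem_integerLattice _).mpr ⟨Pi.single j 1, ?_⟩
      ext i
      simp [Pi.single_apply]
    obtain ⟨z, hz⟩ := (mem_latticeOf_columns _ _).mp hmem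
    rw [Matrix.mulVec_single_one] at hz
    exact ⟨z, WithLp.toLp_injective 2 hz⟩
  choose z hz using hcol
  refine ⟨Matrix.of fun i j => z j i, ?_⟩
  ext i j
  exact congrFun (hz j) i

/-- A unimodular change of basis does not change the lattice. -/
theorem image_integerLattice {B : Matrix (Fin n) (Fin n) ℝ} {U U' : Matrix (Fin n) (Fin n) ℤ}
    (hU : U * U' = 1) :
    Matrix.toEuclideanCLM (n := Fin n) (𝕜 := ℝ) (B * U.map (Int.cast : ℤ → ℝ)) ''
      (integerLattice n : Set (EuclideanSpace ℝ (Fin n))) =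
        (latticeOf (columns B) : Set (EuclideanSpace ℝ (Fin n))) := by
  have hcast : ∀ (V : Matrix (Fin n) (Fin n) ℤ) (z : Fin n → ℤ),
      (V.map (Int.cast : ℤ → ℝ)).mulVec (fun i => (z i : ℝ)) =
        fun i => ((V.mulVec z i : ℤ) : ℝ) := by
    intro V z
    funext i
    simp [Matrix.mulVec, dotProduct]
  ext x
  rw [SetLike.mem_coe, mem_latticeOf_columns]
  constructor
  · rintro ⟨y, hy, rfl⟩
    obtain ⟨z, rfl⟩ := (mem_integerLattice _).mp hy
    exact ⟨U.mulVec z, by rw [toEuclideanCLM_toLp, ← Matrix.mulVec_mulVec, hcast]⟩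
  · rintro ⟨z, rfl⟩
    refine ⟨WithLp.toLp 2 fun i => ((U'.mulVec z i : ℤ) : ℝ),
      (mem_integerLattice _).mpr ⟨_, rfl⟩, ?_⟩
    rw [toEuclideanCLM_toLp, ← Matrix.mulVec_mulVec, hcast, Matrix.mulVec_mulVec, hU,
      Matrix.one_mulVec]

theorem HasBalancedBasis.exists_mem_distortionValues {B : Matrix (Fin n) (Fin n) ℝ} {K : ℝ}
    (h : HasBalancedBasis B K) (hK : 0 ≤ K) :
    ∃ κ ∈ distortionValues (integerLattice n) (latticeOf (columns B)), κ ≤ (n * K) ^ 2 := by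
  obtain ⟨U, U', A, hU, hA, hB, hAb⟩ := h
  refine ⟨_, ⟨_, Matrix.isUnit_det_of_right_inverse hA, image_integerLattice hU, rfl⟩, ?_⟩
  rw [condNumber, Matrix.inv_eq_right_inv hA, sq]
  exact mul_le_mul (opNorm_le_of_abs_apply_le hK hB) (opNorm_le_of_abs_apply_le hK hAb)
    (opNorm_nonneg _) (by positivity)

/-- The inverse of a map from `ℤⁿ` onto `L(B)` sends the first column of `B`, a unit vector, to a
nonzero integer vector. -/
theorem one_le_opNorm_inv {B T : Matrix (Fin (n + 1)) (Fin (n + 1)) ℝ}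
    (hB : IsUnitriangularOver (EuclideanSpace.basisFun (Fin (n + 1)) ℝ) (columns B))
    (hT : IsUnit T.det)
    (h : Matrix.toEuclideanCLM (n := Fin (n + 1)) (𝕜 := ℝ) T ''
      (integerLattice (n + 1) : Set (EuclideanSpace ℝ (Fin (n + 1)))) =
        (latticeOf (columns B) : Set (EuclideanSpace ℝ (Fin (n + 1))))) :
    1 ≤ opNorm T⁻¹ := by
  have hnorm : ‖columns B 0‖ = 1 := by rw [hB.first_eq, hB.orthonormal.1]
  have hmem : columns B 0 ∈ (latticeOf (columns B) : Set (EuclideanSpace ℝ (Fin (n + 1)))) :=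
    Submodule.subset_span ⟨0, rfl⟩
  rw [← h] at hmem
  obtain ⟨y, hy, hTy⟩ := hmem
  have hy0 : y ≠ 0 := by
    rintro rfl
    rw [map_zero] at hTy
    rw [← hTy, norm_zero] at hnorm
    exact zero_ne_one hnorm
  have hy1 : 1 ≤ ‖y‖ := by
    rw [← latticeOf_columns_one] at hy
    exact (isUnitriangularOver_one (n + 1)).one_le_norm hy hy0
  have hinv : Matrix.toEuclideanCLM (n := Fin (n + 1)) (𝕜 := ℝ) T⁻¹ (columns B 0) = y := by
    rw [← hTy, ← mul_apply_eq_comp, ← map_mul, Matrix.nonsing_inv_mul _ hT, map_one,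
      one_apply_eq_self]
  have hle := (Matrix.toEuclideanCLM (n := Fin (n + 1)) (𝕜 := ℝ) T⁻¹).le_opNorm (columns B 0)
  rw [hinv, hnorm, mul_one] at hle
  exact hy1.trans hle

theorem finite_setOf_abs_apply_le (n : ℕ) (M : ℝ) :
    {U : Matrix (Fin n) (Fin n) ℤ | ∀ i j, |(U i j : ℝ)| ≤ M}.Finite := by
  have hfin : (Set.pi Set.univ fun _ : Fin n =>
      Set.pi Set.univ fun _ : Fin n => Set.Icc (-⌈M⌉) ⌈M⌉).Finite :=
    Set.Finite.pi fun _ => Set.Finite.pi fun _ => Set.finite_Icc _ _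
  refine hfin.subset fun U hU i _ j _ => ?_
  obtain ⟨h1, h2⟩ := abs_le.mp ((hU i j).trans (Int.le_ceil M))
  exact ⟨by exact_mod_cast h1, by exact_mod_cast h2⟩

/-- A map `T` with `κ(T) ≤ M` has `‖T‖ ≤ M`, so the integer matrix `B⁻¹ * T` has bounded entries. -/
theorem finite_distortionValues_inter_Iic {B : Matrix (Fin (n + 1)) (Fin (n + 1)) ℝ}
    (hB : IsUnitriangularOver (EuclideanSpace.basisFun (Fin (n + 1)) ℝ) (columns B))
    (hdet : IsUnit B.det) (M : ℝ) :
    (distortionValues (integerLattice (n + 1)) (latticeOf (columns B)) ∩ Set.Iic M).Finite := by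
  refine ((finite_setOf_abs_apply_le (n + 1)
    (Fintype.card (Fin (n + 1)) * (opNorm B⁻¹ * M))).image
      fun U => condNumber (B * U.map (Int.cast : ℤ → ℝ))).subset ?_
  rintro κ ⟨⟨T, hT, himage, rfl⟩, hκ⟩
  obtain ⟨U, rfl⟩ := exists_eq_mul_map_of_image himage
  refine ⟨U, fun i j => ?_, rfl⟩
  have hTM : opNorm (B * U.map (Int.cast : ℤ → ℝ)) ≤ M :=
    (le_mul_of_one_le_right (opNorm_nonneg _) (one_le_opNorm_inv hB hT himage)).trans hκ
  have hU : U.map (Int.cast : ℤ → ℝ) = B⁻¹ * (B * U.map (Int.cast : ℤ → ℝ)) := by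
    rw [Matrix.nonsing_inv_mul_cancel_left _ _ hdet]
  have hUij : (U i j : ℝ) = (B⁻¹ * (B * U.map (Int.cast : ℤ → ℝ))) i j := by
    rw [← hU, Matrix.map_apply]
  rw [hUij]
  exact abs_mul_apply_le _ _ (opNorm_nonneg _) (abs_apply_le_opNorm _)
    (fun k l => (abs_apply_le_opNorm _ k l).trans hTM) i j

end Distortion

/-- A nonempty set of reals that is finite below every bound attains its infimum. -/
theorem isLeast_csInf_of_finite_inter_Iic {S : Set ℝ} (hne : S.Nonempty)
    (hfin : ∀ M, (S ∩ Set.Iic M).Finite) : IsLeast S (sInf S) := by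
  obtain ⟨x, hx⟩ := hne
  obtain ⟨m, hm, hmin⟩ := Set.exists_min_image _ id (hfin x) ⟨x, hx, Set.mem_Iic.mpr le_rfl⟩
  have hleast : IsLeast S m := by
    refine ⟨hm.1, fun y hy => ?_⟩
    rcases le_total y x with h | h
    · exact hmin y ⟨hy, h⟩
    · exact (Set.mem_Iic.mp hm.2).trans h
  rwa [hleast.csInf_eq]

theorem isLeast_latticeDist_lukTracy {n : ℕ} (hn : 1 ≤ n) :
    IsLeast (distortionValues (integerLattice n) (latticeOf (columns (lukTracy n))))
      (latticeDist (integerLattice n) (latticeOf (columns (lukTracy n)))) := by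
  obtain ⟨m, rfl⟩ : ∃ m, n = m + 1 := ⟨n - 1, by omega⟩
  refine isLeast_csInf_of_finite_inter_Iic ?_ (finite_distortionValues_inter_Iic
    (isUnitriangularOver_lukTracy _) (by rw [det_lukTracy]; exact isUnit_one))
  obtain ⟨κ, hκ, -⟩ := (hasBalancedBasis_lukTracy (m + 1)
    (Nat.lt_two_pow_self).le).exists_mem_distortionValues (by positivity)
  exact ⟨κ, hκ⟩

/-- With `2 ^ k ≤ n ^ 2`, that is `k * log 2 ≤ 2 * log n`, both factors of the left-hand side are
powers of `n` with an exponent of the order of `log n`. -/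
theorem mul_two_pow_sq_sq_le {n k : ℕ} (hn : 1 ≤ n) (hk : 2 ^ k ≤ n ^ 2) :
    ((n : ℝ) * 2 ^ k ^ 2) ^ 2 ≤ (n : ℝ) ^ (20 * Real.log n) := by
  have hn0 : (0 : ℝ) < n := by exact_mod_cast hn
  have hlog2 : 1 / 2 ≤ Real.log 2 := by linarith [Real.log_two_gt_d9]
  have hkL : k * Real.log 2 ≤ 2 * Real.log n := by
    have h : ((2 : ℝ) ^ k) ≤ (n : ℝ) ^ 2 := by exact_mod_cast hk
    simpa using Real.log_le_log (by positivity) h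
  have hL : 0 ≤ Real.log n := Real.log_natCast_nonneg n
  -- At `n = 1` both sides vanish; otherwise `log n ≥ log 2 ≥ 1 / 2`.
  have hL2 : Real.log n ≤ 2 * Real.log n ^ 2 := by
    rcases hn.eq_or_lt with rfl | h2
    · simp
    · have : Real.log 2 ≤ Real.log n := Real.log_le_log two_pos (by exact_mod_cast h2)
      nlinarith
  have hk2 : (k : ℝ) ^ 2 * Real.log 2 ≤ 8 * Real.log n ^ 2 := by
    have hk0 : (0 : ℝ) ≤ k * Real.log 2 := by positivity
    have hsq : (k * Real.log 2) ^ 2 ≤ (2 * Real.log n) ^ 2 := pow_le_pow_left₀ hk0 hkL 2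
    have : (k : ℝ) ^ 2 * Real.log 2 ≤ 2 * (k * Real.log 2) ^ 2 := by
      have h0 : (0 : ℝ) ≤ (k : ℝ) ^ 2 * Real.log 2 := by positivity
      nlinarith
    linarith
  rw [← Real.log_le_log_iff (by positivity) (by positivity), Real.log_rpow hn0, Real.log_pow,
    Real.log_mul hn0.ne' (by positivity), Real.log_pow]
  push_cast
  nlinarith

theorem latticeDist_lukTracy_le {n : ℕ} (hn : 1 ≤ n) :
    latticeDist (integerLattice n) (latticeOf (columns (lukTracy n))) ≤
      (n : ℝ) ^ (20 * Real.log n) := by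
  have hpow : 2 ^ Nat.clog 2 n ≤ n ^ 2 := by
    rcases hn.eq_or_lt with rfl | h2
    · simp
    · have hlt := Nat.pow_pred_clog_lt_self one_lt_two h2
      have hpos := Nat.clog_pos one_lt_two h2
      obtain ⟨c, hc⟩ : ∃ c, Nat.clog 2 n = c + 1 := ⟨Nat.clog 2 n - 1, by omega⟩
      rw [hc, Nat.pred_succ] at hlt
      rw [hc, pow_succ]
      nlinarith
  obtain ⟨κ, hκ, hle⟩ := (hasBalancedBasis_lukTracy (Nat.clog 2 n)
    (Nat.le_pow_clog one_lt_two n)).exists_mem_distortionValues (by positivity)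
  exact ((isLeast_latticeDist_lukTracy hn).2 hκ).trans
    (hle.trans (mul_two_pow_sq_sq_le hn hpow))

/-- Quasi-polynomial growth is slower than exponential growth. -/
theorem exists_rpow_mul_log_le (C : ℝ) {a : ℝ} (ha : 1 < a) :
    ∃ M : ℝ, 0 < M ∧ ∀ n : ℕ, 1 ≤ n → (n : ℝ) ^ (C * Real.log n) ≤ M * a ^ n := by
  have hloga : 0 < Real.log a := Real.log_pos ha
  have hev : ∀ᶠ n : ℕ in Filter.atTop, (n : ℝ) ^ (C * Real.log n) / a ^ n ≤ 1 := by
    have ho := ((Real.isLittleO_pow_log_id_atTop (n := 2)).const_mul_left C).bound hloga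
    filter_upwards [tendsto_natCast_atTop_atTop.eventually ho, Filter.eventually_ge_atTop 1]
      with n hn hn1
    have hn0 : (0 : ℝ) < n := by exact_mod_cast hn1
    have hle : C * Real.log n ^ 2 ≤ Real.log a * n := by
      simpa using (le_abs_self _).trans hn
    rw [div_le_one (by positivity), ← Real.log_le_log_iff (by positivity) (by positivity),
      Real.log_rpow hn0, Real.log_pow]
    linarith
  obtain ⟨N, hN⟩ := Filter.eventually_atTop.mp hev
  -- The sum takes care of the finitely many small dimensions.
  refine ⟨1 + ∑ n ∈ Finset.range N, (n : ℝ) ^ (C * Real.log n) / a ^ n, by positivity,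
    fun n _ => ?_⟩
  rw [← div_le_iff₀ (by positivity)]
  have hnonneg : ∀ n ∈ Finset.range N, 0 ≤ (n : ℝ) ^ (C * Real.log n) / a ^ n :=
    fun n _ => by positivity
  rcases le_or_gt N n with h | h
  · exact (hN n h).trans (le_add_of_nonneg_right (Finset.sum_nonneg hnonneg))
  · exact (Finset.single_le_sum hnonneg (Finset.mem_range.mpr h)).trans
      (le_add_of_nonneg_left zero_le_one)

theorem exists_pow_mul_latticeDist_le_condNumber :
    ∃ c a : ℝ, 0 < c ∧ 1 < a ∧ ∀ n : ℕ, 1 ≤ n →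
      c * a ^ n * latticeDist (integerLattice n) (latticeOf (columns (lukTracy n))) ≤
        condNumber (lukTracy n) := by
  obtain ⟨M, hM, hbound⟩ := exists_rpow_mul_log_le 20 (a := 6 / 5) (by norm_num)
  -- The rate `3 / 2` is split as `5 / 4 * (6 / 5)`; the factor `6 / 5` absorbs the distortion.
  refine ⟨2 / 9 / M, 5 / 4, by positivity, by norm_num, fun n hn => ?_⟩
  calc 2 / 9 / M * (5 / 4) ^ n *
        latticeDist (integerLattice n) (latticeOf (columns (lukTracy n)))
      ≤ 2 / 9 / M * (5 / 4) ^ n * (M * (6 / 5) ^ n) :=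
        mul_le_mul_of_nonneg_left ((latticeDist_lukTracy_le hn).trans (hbound n hn))
          (by positivity)
    _ = 2 / 9 * (5 / 4 * (6 / 5)) ^ n := by
        rw [mul_pow]
        field_simp
    _ = 2 / 9 * (3 / 2 : ℝ) ^ n := by norm_num
    _ ≤ condNumber (lukTracy n) := pow_le_condNumber_lukTracy hn

end LatticeDistortion

theorem theorem5p3 :
    -- every `Bₙ` is an HKZ-reduced basis of the lattice it generates, and so is `Iₙ` of `ℤⁿ`
    (∀ n : ℕ, 1 ≤ n →
      LatticeDistortion.IsHKZ n (LatticeDistortion.columns (LatticeDistortion.lukTracy n))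
        (LatticeDistortion.latticeOf
          (LatticeDistortion.columns (LatticeDistortion.lukTracy n))) ∧
      LatticeDistortion.IsHKZ n
        (LatticeDistortion.columns (1 : Matrix (Fin n) (Fin n) ℝ))
        (LatticeDistortion.integerLattice n)) ∧
    -- `κ(Bₙ) = Ω(1.5ⁿ)`
    (∃ c : ℝ, 0 < c ∧ ∀ n : ℕ, 1 ≤ n →
      c * (3 / 2 : ℝ) ^ n ≤ LatticeDistortion.condNumber (LatticeDistortion.lukTracy n)) ∧
    -- the distortion is attained, and it is `n ^ O(log n)`
    (∃ C : ℝ, 0 < C ∧ ∀ n : ℕ, 1 ≤ n →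
      IsLeast
        (LatticeDistortion.distortionValues (LatticeDistortion.integerLattice n)
          (LatticeDistortion.latticeOf
            (LatticeDistortion.columns (LatticeDistortion.lukTracy n))))
        (LatticeDistortion.latticeDist (LatticeDistortion.integerLattice n)
          (LatticeDistortion.latticeOf
            (LatticeDistortion.columns (LatticeDistortion.lukTracy n)))) ∧
      LatticeDistortion.latticeDist (LatticeDistortion.integerLattice n)
          (LatticeDistortion.latticeOf
            (LatticeDistortion.columns (LatticeDistortion.lukTracy n))) ≤
        (n : ℝ) ^ (C * Real.log n)) ∧
    -- the map `Bₙ Iₙ⁻¹` between the two HKZ bases misses the optimum by an exponential factor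
    (∃ c a : ℝ, 0 < c ∧ 1 < a ∧ ∀ n : ℕ, 1 ≤ n →
      c * a ^ n *
          LatticeDistortion.latticeDist (LatticeDistortion.integerLattice n)
            (LatticeDistortion.latticeOf
              (LatticeDistortion.columns (LatticeDistortion.lukTracy n))) ≤
        LatticeDistortion.condNumber
          (LatticeDistortion.lukTracy n * (1 : Matrix (Fin n) (Fin n) ℝ)⁻¹)) := by

  refine ⟨fun n _ => ⟨(LatticeDistortion.isUnitriangularOver_lukTracy n).isHKZ, ?_⟩,
    ⟨2 / 9, by norm_num, fun n hn => LatticeDistortion.pow_le_condNumber_lukTracy hn⟩,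
    ⟨20, by norm_num, fun n hn => ⟨LatticeDistortion.isLeast_latticeDist_lukTracy hn,
      LatticeDistortion.latticeDist_lukTracy_le hn⟩⟩, ?_⟩
  · rw [← LatticeDistortion.latticeOf_columns_one]
    exact (LatticeDistortion.isUnitriangularOver_one n).isHKZ
  · simpa only [inv_one, mul_one] using
      LatticeDistortion.exists_pow_mul_latticeDist_le_condNumber
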